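/- Let formulas be built from a set of propositional variables by the constant $\bot$, the binary connectives $\land,\lor,\to,\prec$ and the unary connective $\Box$. A sequent $\Gamma\Rightarrow\Delta$ is a pair of finite multisets of formulas. The calculus $\mathbf{BiInt}^{\mathbf{S5}}$ (the extension of $\mathbf{G4}$ by the rules $(\prec\mathtt{r})$ and $(\prec\mathtt{l})_\Box$ for coimplication) has the initial sequents $x\Rightarrow x$ for every variable $x$ and the following rules, where $\Box\Gamma$ denotes a multiset of formulas all of the form $\Box F$. Structural rules: weakening (from $\Gamma\Rightarrow\Delta$ infer $\Gamma,\Gamma'\Rightarrow\Delta,\Delta'$); contraction (reduce the multiplicities of formulas on either side, keeping at least one copy of each formula that occurs on that side); and multicut, for $p,q\ge 1$ and any formula $C$ (the cut formula), $$\frac{\Gamma\Rightarrow\Delta,C^p\qquad \Gamma',C^q\Rightarrow\Delta'}{\Gamma,\Gamma'\Rightarrow\Delta,\Delta'}$$ where $C^n$ denotes $n$ copies of $C$. Logical rules: $$\frac{}{\Gamma,\bot\Rightarrow\Delta}\qquad \frac{\Gamma\Rightarrow\Delta}{\Gamma\Rightarrow\bot,\Delta}\qquad \frac{\Gamma,A,B\Rightarrow\Delta}{\Gamma,A\land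 B\Rightarrow\Delta}\qquad \frac{\Gamma\Rightarrow A,\Delta\quad \Gamma\Rightarrow B,\Delta}{\Gamma\Rightarrow A\land B,\Delta}$$ $$\frac{\Gamma,A\Rightarrow\Delta\quad \Gamma,B\Rightarrow\Delta}{\Gamma,A\lor B\Rightarrow\Delta}\qquad \frac{\Gamma\Rightarrow A,B,\Delta}{\Gamma\Rightarrow A\lor B,\Delta}\qquad \frac{\Gamma\Rightarrow A,\Delta\quad \Gamma,B\Rightarrow\Delta}{\Gamma,A\to B\Rightarrow\Delta}\qquad (\to\mathtt{r})_\Box\ \frac{\Gamma,A\Rightarrow B,\Box\Delta}{\Gamma\Rightarrow A\to B,\Box\Delta}$$ $$(\prec\mathtt{l})_\Box\ \frac{A,\Box\Gamma\Rightarrow B,\Delta}{A\prec B,\Box\Gamma\Rightarrow\Delta}\qquad (\prec\mathtt{r})\ \frac{\Gamma\Rightarrow A,\Delta\quad \Gamma,B\Rightarrow\Delta}{\Gamma\Rightarrow A\prec B,\Delta}\qquad (T)\ \frac{\Gamma,A\Rightarrow\Delta}{\Gamma,\Box A\Rightarrow\Delta}\qquad (5)\ \frac{\Box\Gamma\Rightarrow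 A,\Box\Delta}{\Box\Gamma\Rightarrow\Box A,\Box\Delta}$$ A proof of a sequent is a finite tree of sequents with that sequent as its root, composed of instances of these rules, all of whose leaves are initial sequents or conclusions of rules without premises. A proof is locally analytic if in every multicut in it the cut formula is a subformula of some formula in the conclusion of that multicut (every formula being a subformula of itself). Corollary. $\mathbf{BiInt}^{\mathbf{S5}}$ has the analytic cut property: every sequent that has a proof in $\mathbf{BiInt}^{\mathbf{S5}}$ has a locally analytic proof in $\mathbf{BiInt}^{\mathbf{S5}}$. -/

import Mathlib

namespace BiIntS5

universe u

/-- Formulas over the variables `V` in the language `∧, ∨, →, ⊥, □, ≺`. -/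
inductive Fml (V : Type u) : Type u
  | var (x : V) : Fml V
  | bot : Fml V
  | and (A B : Fml V) : Fml V
  | or (A B : Fml V) : Fml V
  | imp (A B : Fml V) : Fml V
  | coimp (A B : Fml V) : Fml V
  | box (A : Fml V) : Fml V

/-- The set of all subformulas of a formula, including the formula itself. -/
def Fml.subformulas {V : Type u} : Fml V → Set (Fml V)
  | .var x => {.var x}
  | .bot => {.bot}
  | .and A B => {.and A B} ∪ (A.subformulas ∪ B.subformulas)
  | .or A B => {.or A B} ∪ (A.subformulas ∪ B.subformulas)
  | .imp A B => {.imp A B} ∪ (A.subformulas ∪ B.subformulas)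
  | .coimp A B => {.coimp A B} ∪ (A.subformulas ∪ B.subformulas)
  | .box A => {.box A} ∪ A.subformulas

/-- Labelled formulas: `left A` is an occurrence of `A` in the antecedent of a sequent,
`right A` an occurrence in the succedent. -/
inductive LFml (V : Type u) : Type u
  | left (A : Fml V) : LFml V
  | right (A : Fml V) : LFml V

/-- The formula underlying a labelled formula. -/
def LFml.formula {V : Type u} : LFml V → Fml V
  | .left A => A
  | .right A => A

/-- The sequent `A₁, …, Aₙ ⇒ B₁, …, Bₘ` is the multiset
`{left A₁, …, left Aₙ, right B₁, …, right Bₘ}`. -/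
abbrev Sequent (V : Type u) : Type u := Multiset (LFml V)

/-- Names of the logical rules: a left and a right rule for every connective. -/
inductive Rule : Type
  | botL | botR | andL | andR | orL | orR | impL | impR | coimpL | coimpR | boxL | boxR

open LFml in
/-- `R.Scheme P [Λ₁, …, Λₘ]`: the rule `R` may introduce the principal formula `P` from
premises whose auxiliary formulas are `Λ₁, …, Λₘ`. -/
inductive Rule.Scheme {V : Type u} : Rule → LFml V → List (Sequent V) → Prop
  | botL : Rule.Scheme .botL (left .bot) []
  | botR : Rule.Scheme .botR (right .bot) [0]
  | andL (A B : Fml V) : Rule.Scheme .andL (left (.and A B)) [{left A, left B}]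
  | andR (A B : Fml V) : Rule.Scheme .andR (right (.and A B)) [{right A}, {right B}]
  | orL (A B : Fml V) : Rule.Scheme .orL (left (.or A B)) [{left A}, {left B}]
  | orR (A B : Fml V) : Rule.Scheme .orR (right (.or A B)) [{right A, right B}]
  | impL (A B : Fml V) : Rule.Scheme .impL (left (.imp A B)) [{right A}, {left B}]
  | impR (A B : Fml V) : Rule.Scheme .impR (right (.imp A B)) [{left A, right B}]
  | coimpL (A B : Fml V) : Rule.Scheme .coimpL (left (.coimp A B)) [{left A, right B}]
  | coimpR (A B : Fml V) : Rule.Scheme .coimpR (right (.coimp A B)) [{right A}, {left B}]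
  | boxL (A : Fml V) : Rule.Scheme .boxL (left (.box A)) [{left A}]
  | boxR (A : Fml V) : Rule.Scheme .boxR (right (.box A)) [{right A}]

/-- The context restriction of a rule: the set of labelled formulas that its context may
contain. Only `(→r)_□`, `(≺l)_□` and the right rule for `□` are restricted. -/
def Rule.context (V : Type u) : Rule → Set (LFml V)
  | .impR => {F | (∃ A, F = .left A) ∨ ∃ A, F = .right (.box A)}
  | .coimpL => {F | (∃ A, F = .left (.box A)) ∨ ∃ A, F = .right A}
  | .boxR => {F | (∃ A, F = .left (.box A)) ∨ ∃ A, F = .right (.box A)}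
  | _ => Set.univ

/-- `Γ'` is a contraction of `Γ`: it has the same support and no larger multiplicities. -/
def IsContraction {V : Type u} (Γ' Γ : Sequent V) : Prop :=
  (∀ F, F ∈ Γ' ↔ F ∈ Γ) ∧ Γ' ≤ Γ

/-- `Proof S` is the type of proofs (with cuts) of the sequent `S`. -/
inductive Proof {V : Type u} : Sequent V → Type u
  | init (x : V) : Proof {LFml.left (.var x), LFml.right (.var x)}
  | weakening (Γ Δ : Sequent V) (π : Proof Γ) : Proof (Γ + Δ)
  | contraction (Γ Γ' : Sequent V) (h : IsContraction Γ' Γ) (π : Proof Γ) : Proof Γ'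
  | mcut (Γ Δ : Sequent V) (C : Fml V) (p q : ℕ) (hp : p ≠ 0) (hq : q ≠ 0)
      (π₁ : Proof (Γ + Multiset.replicate p (LFml.right C)))
      (π₂ : Proof (Δ + Multiset.replicate q (LFml.left C))) : Proof (Γ + Δ)
  | logical (R : Rule) (P : LFml V) (Λ : List (Sequent V)) (hR : R.Scheme P Λ)
      (Γ : Sequent V) (hΓ : ∀ F ∈ Γ, F ∈ R.context V)
      (π : ∀ i : Fin Λ.length, Proof (Γ + Λ.get i)) : Proof (Γ + {P})

/-- A proof is locally analytic if in each of its cuts the cut formula is a subformula of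
some formula in the conclusion of that cut. -/
def Proof.LocallyAnalytic {V : Type u} : {S : Sequent V} → Proof S → Prop
  | _, .init _ => True
  | _, .weakening _ _ π => π.LocallyAnalytic
  | _, .contraction _ _ _ π => π.LocallyAnalytic
  | _, .mcut Γ Δ C _ _ _ _ π₁ π₂ =>
      (∃ F ∈ Γ + Δ, C ∈ F.formula.subformulas) ∧ π₁.LocallyAnalytic ∧ π₂.LocallyAnalytic
  | _, .logical _ _ _ _ _ _ π => ∀ i, (π i).LocallyAnalytic

end BiIntS5

namespace BiIntS5

open LFml

variable {V : Type u}

/-! The argument is semantic: no proof is transformed. All rules, including cut on an arbitrary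
formula, are sound for preordered Kripke models with persistent valuation and universal `□`
(`Proof.sound`). Conversely, a sequent without a locally analytic proof has a countermodel. Cuts on
its finitely many subformulas extend it to a saturated sequent (`exists_saturated`), and the
saturated sequents with the same boxed formulas are the worlds of a model in which each refutes
itself (`World.truth`).

Worlds may decide different sets of formulas, so accessibility asks for two inclusions: antecedents
grow and succedents shrink. A successor contains only subformulas of its predecessor, which
therefore decides them; this yields the second inclusion from the first, and dually for `≺`. -/

theorem Fml.self_mem_subformulas (A : Fml V) : A ∈ A.subformulas := by
  cases A <;> simp [Fml.subformulas]

theorem Fml.subformulas_finite (A : Fml V) : A.subformulas.Finite := by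
  induction A <;> simp_all [Fml.subformulas]

theorem Fml.subformulas_trans {A B C : Fml V} (hAB : A ∈ B.subformulas)
    (hBC : B ∈ C.subformulas) : A ∈ C.subformulas := by
  induction C with
  | var | bot =>
    simp only [Fml.subformulas, Set.mem_singleton_iff] at hBC
    subst hBC
    exact hAB
  | and _ _ ih₁ ih₂ | or _ _ ih₁ ih₂ | imp _ _ ih₁ ih₂ | coimp _ _ ih₁ ih₂ =>
    rcases hBC with rfl | h | h
    · exact hAB
    · exact Or.inr (Or.inl (ih₁ h))
    · exact Or.inr (Or.inr (ih₂ h))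
  | box _ ih =>
    rcases hBC with rfl | h
    · exact hAB
    · exact Or.inr (ih h)

/-! ### Kripke semantics -/

/-- Forcing in a Kripke model: `→` looks up along `r`, `≺` looks down, and `□` quantifies over
all worlds. -/
def Fml.Forces {W : Type u} (r : W → W → Prop) (val : V → W → Prop) : Fml V → W → Prop
  | .var x, w => val x w
  | .bot, _ => False
  | .and A B, w => A.Forces r val w ∧ B.Forces r val w
  | .or A B, w => A.Forces r val w ∨ B.Forces r val w
  | .imp A B, w => ∀ v, r w v → A.Forces r val v → B.Forces r val v
  | .coimp A B, w => ∃ v, r v w ∧ A.Forces r val v ∧ ¬ B.Forces r val v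
  | .box A, _ => ∀ v, A.Forces r val v

/-- A labelled formula holds at a world if it is a forced antecedent formula or a succedent
formula that is not forced. -/
def LFml.Holds {W : Type u} (r : W → W → Prop) (val : V → W → Prop) : LFml V → W → Prop
  | .left A, w => A.Forces r val w
  | .right A, w => ¬ A.Forces r val w

section Soundness

variable {W : Type u} {r : W → W → Prop} {val : V → W → Prop}

theorem Fml.Forces.mono (htrans : ∀ a b c, r a b → r b c → r a c)
    (hval : ∀ x w v, r w v → val x w → val x v) (A : Fml V) {w v : W} (hwv : r w v)
    (h : A.Forces r val w) : A.Forces r val v := by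
  induction A generalizing w v with
  | var x => exact hval x w v hwv h
  | bot => exact h
  | and A B ihA ihB => exact ⟨ihA hwv h.1, ihB hwv h.2⟩
  | or A B ihA ihB => exact h.imp (ihA hwv) (ihB hwv)
  | imp A B => exact fun u hu => h u (htrans _ _ _ hwv hu)
  | coimp A B =>
    obtain ⟨u, hu, h⟩ := h
    exact ⟨u, htrans _ _ _ hu hwv, h⟩
  | box A => exact h

/-- Soundness read upwards, possibly at another world. The context restrictions describe what
survives the move: persistence carries antecedents up and succedents down, and boxed formulas hold
everywhere or nowhere. -/
theorem Rule.Scheme.sound (hrefl : ∀ a, r a a) (htrans : ∀ a b c, r a b → r b c → r a c)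
    (hval : ∀ x w v, r w v → val x w → val x v)
    {R : Rule} {P : LFml V} {Λ : List (Sequent V)} (hR : R.Scheme P Λ) {Γ : Sequent V}
    (hΓ : ∀ F ∈ Γ, F ∈ R.context V) {w : W} (hw : ∀ F ∈ Γ, F.Holds r val w)
    (hP : P.Holds r val w) :
    ∃ L ∈ Λ, ∃ v, ∀ F ∈ Γ + L, F.Holds r val v := by
  have key : ∀ (L : Sequent V) (v : W), (∀ F ∈ Γ, F.Holds r val v) →
      (∀ F ∈ L, F.Holds r val v) → ∀ F ∈ Γ + L, F.Holds r val v := fun L v h₁ h₂ F hF =>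
    (Multiset.mem_add.1 hF).elim (h₁ F) (h₂ F)
  cases hR with
  | botL => exact hP.elim
  | botR => exact ⟨0, by simp, w, key _ _ hw (by simp)⟩
  | andL A B =>
    refine ⟨_, List.mem_singleton.2 rfl, w, key _ _ hw ?_⟩
    simpa [LFml.Holds, Fml.Forces] using hP
  | andR A B =>
    by_cases hA : A.Forces r val w
    · refine ⟨{right B}, by simp, w, key _ _ hw ?_⟩
      have : ¬ B.Forces r val w := fun hB => hP ⟨hA, hB⟩
      simpa [LFml.Holds] using this
    · exact ⟨{right A}, by simp, w, key _ _ hw (by simpa [LFml.Holds] using hA)⟩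
  | orL A B =>
    rcases hP with h | h
    · exact ⟨{left A}, by simp, w, key _ _ hw (by simpa [LFml.Holds] using h)⟩
    · exact ⟨{left B}, by simp, w, key _ _ hw (by simpa [LFml.Holds] using h)⟩
  | orR A B =>
    refine ⟨_, List.mem_singleton.2 rfl, w, key _ _ hw ?_⟩
    simpa [LFml.Holds, Fml.Forces] using hP
  | impL A B =>
    by_cases hA : A.Forces r val w
    · exact ⟨{left B}, by simp, w, key _ _ hw (by simpa [LFml.Holds] using hP w (hrefl w) hA)⟩
    · exact ⟨{right A}, by simp, w, key _ _ hw (by simpa [LFml.Holds] using hA)⟩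
  | impR A B =>
    simp only [LFml.Holds, Fml.Forces, not_forall] at hP
    obtain ⟨v, hwv, hA, hB⟩ := hP
    refine ⟨_, List.mem_singleton.2 rfl, v, key _ _ ?_ (by simp [LFml.Holds, hA, hB])⟩
    intro F hF
    rcases hΓ F hF with ⟨C, rfl⟩ | ⟨C, rfl⟩
    · exact Fml.Forces.mono htrans hval C hwv (hw _ hF)
    · exact hw _ hF
  | coimpL A B =>
    obtain ⟨v, hvw, hA, hB⟩ := hP
    refine ⟨_, List.mem_singleton.2 rfl, v, key _ _ ?_ (by simp [LFml.Holds, hA, hB])⟩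
    intro F hF
    rcases hΓ F hF with ⟨C, rfl⟩ | ⟨C, rfl⟩
    · exact hw _ hF
    · exact fun hC => hw _ hF (Fml.Forces.mono htrans hval C hvw hC)
  | coimpR A B =>
    by_cases hA : A.Forces r val w
    · have hB : B.Forces r val w := by
        by_contra hB
        exact hP ⟨w, hrefl w, hA, hB⟩
      exact ⟨{left B}, by simp, w, key _ _ hw (by simpa [LFml.Holds] using hB)⟩
    · exact ⟨{right A}, by simp, w, key _ _ hw (by simpa [LFml.Holds] using hA)⟩
  | boxL A =>
    exact ⟨_, List.mem_singleton.2 rfl, w, key _ _ hw (by simpa [LFml.Holds] using hP w)⟩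
  | boxR A =>
    simp only [LFml.Holds, Fml.Forces, not_forall] at hP
    obtain ⟨v, hA⟩ := hP
    refine ⟨_, List.mem_singleton.2 rfl, v, key _ _ ?_ (by simp [LFml.Holds, hA])⟩
    intro F hF
    rcases hΓ F hF with ⟨C, rfl⟩ | ⟨C, rfl⟩ <;> exact hw _ hF

theorem Proof.sound (hrefl : ∀ a, r a a) (htrans : ∀ a b c, r a b → r b c → r a c)
    (hval : ∀ x w v, r w v → val x w → val x v) {S : Sequent V} (π : Proof S) (w : W) :
    ¬ ∀ F ∈ S, F.Holds r val w := by
  induction π generalizing w with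
  | init x => exact fun h => h (right (.var x)) (by simp) (h (left (.var x)) (by simp))
  | weakening Γ Δ π ih => exact fun h => ih w fun F hF => h F (Multiset.mem_add.2 (Or.inl hF))
  | contraction Γ Γ' hc π ih => exact fun h => ih w fun F hF => h F ((hc.1 F).2 hF)
  | mcut Γ Δ C p q hp hq π₁ π₂ ih₁ ih₂ =>
    intro h
    by_cases hC : C.Forces r val w
    · refine ih₂ w fun F hF => ?_
      rcases Multiset.mem_add.1 hF with hF | hF
      · exact h F (Multiset.mem_add.2 (Or.inr hF))
      · rw [Multiset.eq_of_mem_replicate hF]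
        exact hC
    · refine ih₁ w fun F hF => ?_
      rcases Multiset.mem_add.1 hF with hF | hF
      · exact h F (Multiset.mem_add.2 (Or.inl hF))
      · rw [Multiset.eq_of_mem_replicate hF]
        exact hC
  | logical R P Λ hR Γ hΓ π ih =>
    intro h
    obtain ⟨L, hL, v, hv⟩ := hR.sound hrefl htrans hval hΓ
      (fun F hF => h F (Multiset.mem_add.2 (Or.inl hF))) (h P (by simp))
    obtain ⟨i, rfl⟩ := List.get_of_mem hL
    exact ih i v hv

end Soundness

/-! ### Locally analytic provability -/

/-- The sequent `S` has a locally analytic proof. -/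
def Analytic (S : Sequent V) : Prop := ∃ π : Proof S, π.LocallyAnalytic

/-- Weaken to `S + T`, then contract to `T`. Hence only the support of a sequent matters below. -/
theorem Analytic.mono {S T : Sequent V} (hS : Analytic S) (h : S ⊆ T) : Analytic T := by
  obtain ⟨π, hπ⟩ := hS
  have hc : IsContraction T (S + T) := by
    refine ⟨fun F => ?_, Multiset.le_add_left _ _⟩
    rw [Multiset.mem_add]
    exact ⟨Or.inr, fun hF => hF.elim (fun hF => h hF) id⟩
  refine ⟨.contraction (S + T) T hc (.weakening S T π), ?_⟩
  rw [Proof.LocallyAnalytic, Proof.LocallyAnalytic]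
  exact hπ

theorem Analytic.init {S : Sequent V} {x : V} (hl : left (.var x) ∈ S)
    (hr : right (.var x) ∈ S) : Analytic S :=
  Analytic.mono ⟨.init x, trivial⟩ fun F hF => by
    simp only [Multiset.insert_eq_cons, Multiset.mem_cons, Multiset.mem_singleton] at hF
    rcases hF with rfl | rfl <;> assumption

theorem Analytic.logical {R : Rule} {P : LFml V} {Λ : List (Sequent V)} (hR : R.Scheme P Λ)
    {Γ S : Sequent V} (hΓ : ∀ F ∈ Γ, F ∈ R.context V) (hΓS : Γ ⊆ S) (hP : P ∈ S)
    (h : ∀ L ∈ Λ, Analytic (Γ + L)) : Analytic S := by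
  choose π hπ using fun i : Fin Λ.length => h (Λ.get i) (List.get_mem Λ i)
  refine Analytic.mono ⟨.logical R P Λ hR Γ hΓ π, hπ⟩ fun F hF => ?_
  rcases Multiset.mem_add.1 hF with hF | hF
  · exact hΓS hF
  · rwa [Multiset.mem_singleton.1 hF]

theorem Analytic.cut {S : Sequent V} {C : Fml V} (hC : ∃ F ∈ S, C ∈ F.formula.subformulas)
    (h₁ : Analytic (S + {right C})) (h₂ : Analytic (S + {left C})) : Analytic S := by
  obtain ⟨π₁, hπ₁⟩ := h₁
  obtain ⟨π₂, hπ₂⟩ := h₂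
  obtain ⟨F, hF, hCF⟩ := hC
  refine Analytic.mono (S := S + S)
    ⟨.mcut S S C 1 1 one_ne_zero one_ne_zero π₁ π₂,
      ⟨F, Multiset.mem_add.2 (Or.inl hF), hCF⟩, hπ₁, hπ₂⟩ fun G hG => ?_
  exact (Multiset.mem_add.1 hG).elim id id

/-- Initial sequents cover variables only. For `→`, `≺` and `□` the restricted rule is applied
first, keeping in its context just the one formula that the second rule needs. -/
theorem Analytic.identity (A : Fml V) {S : Sequent V} (hl : left A ∈ S) (hr : right A ∈ S) :
    Analytic S := by
  induction A generalizing S with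
  | var x => exact Analytic.init hl hr
  | bot => exact Analytic.logical .botL (Γ := 0) (by simp) (by simp) hl (by simp)
  | and A B ihA ihB =>
    refine Analytic.logical (.andL A B) (Γ := S) (by simp [Rule.context])
      (fun _ h => h) hl (List.forall_mem_singleton.2 ?_)
    refine Analytic.logical (.andR A B) (Γ := S + {left A, left B}) (by simp [Rule.context])
      (fun _ h => h) (by simp [hr]) ?_
    simp only [List.forall_mem_cons, List.not_mem_nil, false_implies, implies_true, and_true]
    exact ⟨ihA (by simp) (by simp), ihB (by simp) (by simp)⟩
  | or A B ihA ihB =>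
    refine Analytic.logical (.orR A B) (Γ := S) (by simp [Rule.context])
      (fun _ h => h) hr (List.forall_mem_singleton.2 ?_)
    refine Analytic.logical (.orL A B) (Γ := S + {right A, right B}) (by simp [Rule.context])
      (fun _ h => h) (by simp [hl]) ?_
    simp only [List.forall_mem_cons, List.not_mem_nil, false_implies, implies_true, and_true]
    exact ⟨ihA (by simp) (by simp), ihB (by simp) (by simp)⟩
  | imp A B ihA ihB =>
    refine Analytic.logical (.impR A B) (Γ := {left (.imp A B)}) (by simp [Rule.context])
      (by simpa using hl) hr (List.forall_mem_singleton.2 ?_)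
    refine Analytic.logical (.impL A B) (Γ := {left (.imp A B)} + {left A, right B})
      (by simp [Rule.context]) (fun _ h => h) (by simp) ?_
    simp only [List.forall_mem_cons, List.not_mem_nil, false_implies, implies_true, and_true]
    exact ⟨ihA (by simp) (by simp), ihB (by simp) (by simp)⟩
  | coimp A B ihA ihB =>
    refine Analytic.logical (.coimpL A B) (Γ := {right (.coimp A B)}) (by simp [Rule.context])
      (by simpa using hr) hl (List.forall_mem_singleton.2 ?_)
    refine Analytic.logical (.coimpR A B) (Γ := {right (.coimp A B)} + {left A, right B})
      (by simp [Rule.context]) (fun _ h => h) (by simp) ?_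
    simp only [List.forall_mem_cons, List.not_mem_nil, false_implies, implies_true, and_true]
    exact ⟨ihA (by simp) (by simp), ihB (by simp) (by simp)⟩
  | box A ihA =>
    refine Analytic.logical (.boxR A) (Γ := {left (.box A)}) (by simp [Rule.context])
      (by simpa using hl) hr (List.forall_mem_singleton.2 ?_)
    refine Analytic.logical (.boxL A) (Γ := {left (.box A)} + {right A})
      (by simp [Rule.context]) (fun _ h => h) (by simp) (List.forall_mem_singleton.2 ?_)
    exact ihA (by simp) (by simp)

theorem Rule.Scheme.mem_subformulas {R : Rule} {P : LFml V} {Λ : List (Sequent V)}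
    (hR : R.Scheme P Λ) {L : Sequent V} (hL : L ∈ Λ) {G : LFml V} (hG : G ∈ L) :
    G.formula ∈ P.formula.subformulas := by
  cases hR <;> simp only [List.mem_cons, List.not_mem_nil, or_false] at hL
  all_goals first
    | subst hL
    | rcases hL with rfl | rfl
  all_goals
    simp only [Multiset.insert_eq_cons, Multiset.mem_cons, Multiset.mem_singleton,
      Multiset.notMem_zero] at hG
  all_goals first
    | subst hG
    | rcases hG with rfl | rfl
  all_goals simp [LFml.formula, Fml.subformulas, Fml.self_mem_subformulas]

/-! ### Saturated sequents -/

/-- The formula `C` is a subformula of a formula of `S`. -/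
def IsSubformula (C : Fml V) (S : Sequent V) : Prop := ∃ F ∈ S, C ∈ F.formula.subformulas

theorem IsSubformula.trans {C D : Fml V} {S : Sequent V} (hCD : C ∈ D.subformulas)
    (hD : IsSubformula D S) : IsSubformula C S :=
  let ⟨F, hF, h⟩ := hD
  ⟨F, hF, Fml.subformulas_trans hCD h⟩

theorem isSubformula_of_mem {F : LFml V} {S : Sequent V} (h : F ∈ S) :
    IsSubformula F.formula S := ⟨F, h, Fml.self_mem_subformulas _⟩

theorem finite_setOf_isSubformula (S : Sequent V) : {C | IsSubformula C S}.Finite := by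
  classical
  refine (S.toFinset.finite_toSet.biUnion fun F _ => F.formula.subformulas_finite).subset ?_
  rintro C ⟨F, hF, hC⟩
  exact Set.mem_biUnion (by simpa using hF) hC

/-- A sequent is saturated if it has no locally analytic proof and decides all its subformulas. -/
structure Saturated (S : Sequent V) : Prop where
  not_analytic : ¬ Analytic S
  decides : ∀ C, IsSubformula C S → left C ∈ S ∨ right C ∈ S

/-- Subformulas of `S` are decided one at a time. If neither side could be added, a cut, analytic
since `S ⊆ T`, would prove `T`. Only subformulas of `S` are added, so the result decides all of its
own. -/
theorem exists_saturated {S : Sequent V} (hS : ¬ Analytic S) :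
    ∃ T, Saturated T ∧ S ⊆ T ∧ ∀ F ∈ T, IsSubformula F.formula S := by
  have key : ∀ s : Set (Fml V), s.Finite → s ⊆ {C | IsSubformula C S} →
      ∃ T, ¬ Analytic T ∧ (∀ C ∈ s, left C ∈ T ∨ right C ∈ T) ∧ S ⊆ T ∧
        ∀ F ∈ T, IsSubformula F.formula S := by
    intro s hs
    induction s, hs using Set.Finite.induction_on with
    | empty => exact fun _ => ⟨S, hS, by simp, fun _ h => h, fun F => isSubformula_of_mem⟩
    | @insert C s _ _ ih =>
      intro hsub
      obtain ⟨hC, hsub⟩ := Set.insert_subset_iff.1 hsub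
      obtain ⟨T, hT, hdec, hST, hsubT⟩ := ih hsub
      have step : ∀ F : LFml V, F = left C ∨ F = right C → ¬ Analytic (T + {F}) →
          ∃ T, ¬ Analytic T ∧ (∀ D ∈ insert C s, left D ∈ T ∨ right D ∈ T) ∧ S ⊆ T ∧
            ∀ F ∈ T, IsSubformula F.formula S := by
        refine fun F hF hTF => ⟨T + {F}, hTF, ?_, ?_, ?_⟩
        · rintro D (rfl | hD)
          · rcases hF with rfl | rfl <;> simp
          · exact (hdec D hD).imp (fun h => Multiset.mem_add.2 (Or.inl h))
              fun h => Multiset.mem_add.2 (Or.inl h)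
        · exact fun G hG => Multiset.mem_add.2 (Or.inl (hST hG))
        · intro G hG
          rcases Multiset.mem_add.1 hG with hG | hG
          · exact hsubT G hG
          · rw [Multiset.mem_singleton.1 hG]
            rcases hF with rfl | rfl <;> exact hC
      by_cases h : Analytic (T + {right C})
      · refine step _ (Or.inl rfl) fun h' => hT (Analytic.cut ?_ h h')
        obtain ⟨F, hF, hCF⟩ := hC
        exact ⟨F, hST hF, hCF⟩
      · exact step _ (Or.inr rfl) h
  obtain ⟨T, hT, hdec, hST, hsub⟩ := key _ (finite_setOf_isSubformula S) subset_rfl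
  exact ⟨T, ⟨hT, fun C ⟨F, hF, hC⟩ => hdec C (IsSubformula.trans hC (hsub F hF))⟩, hST, hsub⟩

namespace Saturated

variable {S : Sequent V}

theorem not_left_and_right (hS : Saturated S) {C : Fml V} (hl : left C ∈ S)
    (hr : right C ∈ S) : False :=
  hS.not_analytic (Analytic.identity C hl hr)

theorem mem_of_not_analytic (hS : Saturated S) {G : LFml V} (hG : IsSubformula G.formula S)
    (h : ¬ Analytic (S + {G})) : G ∈ S := by
  by_contra hGS
  cases G with
  | left A =>
    have hA := (hS.decides A hG).resolve_left hGS
    exact h (Analytic.identity A (by simp) (by simp [hA]))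
  | right A =>
    have hA := (hS.decides A hG).resolve_right hGS
    exact h (Analytic.identity A (by simp [hA]) (by simp))

/-- A saturated sequent is closed under the rules without context restriction, read upwards. -/
theorem exists_premise (hS : Saturated S) {R : Rule} {P : LFml V} {Λ : List (Sequent V)}
    (hR : R.Scheme P Λ) (hctx : R.context V = Set.univ) (hP : P ∈ S) : ∃ L ∈ Λ, L ⊆ S := by
  by_contra! h
  refine hS.not_analytic (Analytic.logical hR (Γ := S) (by simp [hctx]) (fun _ h => h) hP ?_)
  intro L hL
  by_contra hSL
  refine h L hL fun G hG => hS.mem_of_not_analytic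
    ((isSubformula_of_mem hP).trans (hR.mem_subformulas hL hG)) fun hSG => hSL (hSG.mono ?_)
  intro F hF
  rcases Multiset.mem_add.1 hF with hF | hF
  · exact Multiset.mem_add.2 (Or.inl hF)
  · rw [Multiset.mem_singleton.1 hF]
    exact Multiset.mem_add.2 (Or.inr hG)

/-- For every rule, some premise with the largest admissible context extends to a saturated
sequent. -/
theorem exists_successor (hS : Saturated S) {R : Rule} {P : LFml V} {Λ : List (Sequent V)}
    (hR : R.Scheme P Λ) (hP : P ∈ S) :
    ∃ L ∈ Λ, ∃ T, Saturated T ∧ L ⊆ T ∧ (∀ F ∈ S, F ∈ R.context V → F ∈ T) ∧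
      ∀ F ∈ T, IsSubformula F.formula S := by
  classical
  set Γ := S.filter (· ∈ R.context V)
  have hΓ : ∃ L ∈ Λ, ¬ Analytic (Γ + L) := by
    by_contra! h
    exact hS.not_analytic (Analytic.logical hR (fun F hF => (Multiset.mem_filter.1 hF).2)
      (Multiset.filter_subset _ _) hP h)
  obtain ⟨L, hL, hΓL⟩ := hΓ
  obtain ⟨T, hT, hΓT, hsub⟩ := exists_saturated hΓL
  refine ⟨L, hL, T, hT, fun F hF => hΓT (Multiset.mem_add.2 (Or.inr hF)), fun F hF hctx =>
    hΓT (Multiset.mem_add.2 (Or.inl (Multiset.mem_filter.2 ⟨hF, hctx⟩))), fun F hF => ?_⟩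
  obtain ⟨G, hG, hFG⟩ := hsub F hF
  rcases Multiset.mem_add.1 hG with hG | hG
  · exact ⟨G, (Multiset.mem_filter.1 hG).1, hFG⟩
  · exact ((isSubformula_of_mem hP).trans (hR.mem_subformulas hL hG)).trans hFG

end Saturated

/-- Two sequents contain the same boxed formulas on each side. -/
def SameBoxes (S T : Sequent V) : Prop :=
  ∀ C : Fml V, (left (.box C) ∈ S ↔ left (.box C) ∈ T) ∧
    (right (.box C) ∈ S ↔ right (.box C) ∈ T)

theorem Rule.left_box_mem_context (R : Rule) (C : Fml V) : left (.box C) ∈ R.context V := by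
  cases R <;> simp [Rule.context]

theorem Rule.right_box_mem_context (R : Rule) (C : Fml V) : right (.box C) ∈ R.context V := by
  cases R <;> simp [Rule.context]

/-- Every context admits boxed formulas on both sides. Conversely, a boxed formula of `T` is decided
by `S`, and the wrong side would be carried into `T`. -/
theorem Saturated.sameBoxes {S T : Sequent V} (hS : Saturated S) (hT : Saturated T) {R : Rule}
    (hST : ∀ F ∈ S, F ∈ R.context V → F ∈ T) (hsub : ∀ F ∈ T, IsSubformula F.formula S) :
    SameBoxes S T := fun C =>
  ⟨⟨fun h => hST _ h (R.left_box_mem_context C), fun h =>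
    (hS.decides _ (hsub _ h)).resolve_right fun h' =>
      hT.not_left_and_right h (hST _ h' (R.right_box_mem_context C))⟩,
   ⟨fun h => hST _ h (R.right_box_mem_context C), fun h =>
    (hS.decides _ (hsub _ h)).resolve_left fun h' =>
      hT.not_left_and_right (hST _ h' (R.left_box_mem_context C)) h⟩⟩

/-! ### The canonical model -/

/-- The worlds of the canonical model of `S`: saturated sequents with the boxed formulas
of `S`. -/
def World (S : Sequent V) : Type u := {T : Sequent V // Saturated T ∧ SameBoxes S T}

/-- The accessibility relation of the canonical model. -/
def World.Le {S : Sequent V} (w v : World S) : Prop :=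
  (∀ A, left A ∈ w.1 → left A ∈ v.1) ∧ ∀ A, right A ∈ v.1 → right A ∈ w.1

/-- The valuation of the canonical model. -/
def World.val {S : Sequent V} (x : V) (w : World S) : Prop := left (.var x) ∈ w.1

theorem World.exists_successor {S : Sequent V} (w : World S) {R : Rule} {P : LFml V}
    {L : Sequent V} (hR : R.Scheme P [L]) (hP : P ∈ w.1) :
    ∃ v : World S, L ⊆ v.1 ∧ (∀ F ∈ w.1, F ∈ R.context V → F ∈ v.1) ∧
      ∀ F ∈ v.1, IsSubformula F.formula w.1 := by
  obtain ⟨L', hL', T, hT, hLT, hwT, hsub⟩ := w.2.1.exists_successor hR hP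
  obtain rfl := List.mem_singleton.1 hL'
  have hb := w.2.1.sameBoxes hT hwT hsub
  exact ⟨⟨T, hT, fun C => ⟨(w.2.2 C).1.trans (hb C).1, (w.2.2 C).2.trans (hb C).2⟩⟩,
    hLT, hwT, hsub⟩

/-- Two implications rather than an equivalence, since `w` need not decide `A`. -/
theorem World.truth {S : Sequent V} (A : Fml V) (w : World S) :
    (left A ∈ w.1 → A.Forces World.Le World.val w) ∧
      (right A ∈ w.1 → ¬ A.Forces World.Le World.val w) := by
  induction A generalizing w with
  | var x => exact ⟨fun h => h, fun h h' => w.2.1.not_left_and_right h' h⟩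
  | bot =>
    refine ⟨fun h => ?_, fun _ h => h⟩
    simpa using w.2.1.exists_premise .botL rfl h
  | and A B ihA ihB =>
    refine ⟨fun h => ?_, fun h hAB => ?_⟩
    · obtain ⟨L, hL, hLw⟩ := w.2.1.exists_premise (.andL A B) rfl h
      obtain rfl := List.mem_singleton.1 hL
      exact ⟨(ihA w).1 (hLw (by simp)), (ihB w).1 (hLw (by simp))⟩
    · obtain ⟨L, hL, hLw⟩ := w.2.1.exists_premise (.andR A B) rfl h
      simp only [List.mem_cons, List.not_mem_nil, or_false] at hL
      rcases hL with rfl | rfl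
      · exact (ihA w).2 (hLw (by simp)) hAB.1
      · exact (ihB w).2 (hLw (by simp)) hAB.2
  | or A B ihA ihB =>
    refine ⟨fun h => ?_, fun h hAB => ?_⟩
    · obtain ⟨L, hL, hLw⟩ := w.2.1.exists_premise (.orL A B) rfl h
      simp only [List.mem_cons, List.not_mem_nil, or_false] at hL
      rcases hL with rfl | rfl
      · exact Or.inl ((ihA w).1 (hLw (by simp)))
      · exact Or.inr ((ihB w).1 (hLw (by simp)))
    · obtain ⟨L, hL, hLw⟩ := w.2.1.exists_premise (.orR A B) rfl h
      obtain rfl := List.mem_singleton.1 hL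
      exact hAB.elim ((ihA w).2 (hLw (by simp))) ((ihB w).2 (hLw (by simp)))
  | imp A B ihA ihB =>
    refine ⟨fun h v hwv hA => ?_, fun h hAB => ?_⟩
    · obtain ⟨L, hL, hLv⟩ := v.2.1.exists_premise (.impL A B) rfl (hwv.1 _ h)
      simp only [List.mem_cons, List.not_mem_nil, or_false] at hL
      rcases hL with rfl | rfl
      · exact ((ihA v).2 (hLv (by simp)) hA).elim
      · exact (ihB v).1 (hLv (by simp))
    · obtain ⟨v, hLv, hwv, hsub⟩ := w.exists_successor (.impR A B) h
      have hle : ∀ C, left C ∈ w.1 → left C ∈ v.1 := fun C hC => hwv _ hC (Or.inl ⟨C, rfl⟩)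
      refine (ihB v).2 (hLv (by simp)) (hAB v ⟨hle, fun C hC => ?_⟩ ((ihA v).1 (hLv (by simp))))
      -- `w` decides `C`; on the left, `C` would persist to `v`, which has it on the right.
      exact (w.2.1.decides C (hsub _ hC)).resolve_left fun h' =>
        v.2.1.not_left_and_right (hle C h') hC
  | coimp A B ihA ihB =>
    refine ⟨fun h => ?_, ?_⟩
    · obtain ⟨v, hLv, hwv, hsub⟩ := w.exists_successor (.coimpL A B) h
      have hle : ∀ C, right C ∈ w.1 → right C ∈ v.1 := fun C hC => hwv _ hC (Or.inr ⟨C, rfl⟩)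
      refine ⟨v, ⟨fun C hC => ?_, hle⟩, (ihA v).1 (hLv (by simp)), (ihB v).2 (hLv (by simp))⟩
      exact (w.2.1.decides C (hsub _ hC)).resolve_right fun h' =>
        v.2.1.not_left_and_right hC (hle C h')
    · rintro h ⟨v, hvw, hA, hB⟩
      obtain ⟨L, hL, hLv⟩ := v.2.1.exists_premise (.coimpR A B) rfl (hvw.2 _ h)
      simp only [List.mem_cons, List.not_mem_nil, or_false] at hL
      rcases hL with rfl | rfl
      · exact (ihA v).2 (hLv (by simp)) hA
      · exact hB ((ihB v).1 (hLv (by simp)))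
  | box A ihA =>
    refine ⟨fun h v => ?_, fun h hA => ?_⟩
    · obtain ⟨L, hL, hLv⟩ := v.2.1.exists_premise (.boxL A) rfl
        -- The box travels from `w` to `v` through the common `S`.
        ((v.2.2 A).1.1 ((w.2.2 A).1.2 h))
      obtain rfl := List.mem_singleton.1 hL
      exact (ihA v).1 (hLv (by simp))
    · obtain ⟨v, hLv, -⟩ := w.exists_successor (.boxR A) h
      exact (ihA v).2 (hLv (by simp)) (hA v)

theorem Proof.analytic {S : Sequent V} (π : Proof S) : Analytic S := by
  by_contra hS
  obtain ⟨T, hT, hST, -⟩ := exists_saturated hS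
  let w : World T := ⟨T, hT, fun _ => ⟨Iff.rfl, Iff.rfl⟩⟩
  refine π.sound (r := World.Le) (val := World.val) (fun _ => ⟨fun _ h => h, fun _ h => h⟩)
    (fun _ _ _ h₁ h₂ => ⟨fun A h => h₂.1 A (h₁.1 A h), fun A h => h₁.2 A (h₂.2 A h)⟩)
    (fun x _ _ h hx => h.1 (.var x) hx) w fun F hF => ?_
  cases F with
  | left A => exact (World.truth A w).1 (hST hF)
  | right A => exact (World.truth A w).2 (hST hF)

end BiIntS5

theorem mainTheorem7 {V : Type*} (S : BiIntS5.Sequent V) (h : Nonempty (BiIntS5.Proof S)) :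
    ∃ π : BiIntS5.Proof S, π.LocallyAnalytic :=
  h.elim fun π => π.analytic
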